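/- Let $n\ge 0$ and let $f:\mathbb R^n\to\mathbb R$ be a smooth, non-negative Morse–Bott function that is not identically zero; here Morse–Bott means that the set of critical points of $f$ is a disjoint union of smooth embedded submanifolds $C$ of $\mathbb R^n$ such that, at every $x\in C$, the Hessian of $f$ at $x$ restricted to the Euclidean normal space $(T_xC)^\perp$ is non-degenerate. Suppose that $N:=f^{-1}(0)$ is a non-empty smooth embedded submanifold of $\mathbb R^n$. (Submanifolds have no boundary, and their connected components may have different dimensions.) Then for every $p\in N$ there is a non-constant gradient flow of $f$ that converges to $p$ as $t\to\infty$; that is, there are $a\in[-\infty,\infty)$ and a non-constant curve $\gamma:(a,\infty)\to\mathbb R^n$ with $\dot\gamma(t)=-\nabla f(\gamma(t))$ for all $t>a$ and $\lim_{t\to\infty}\gamma(t)=p$. -/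

import Mathlib

open Set Filter Topology
open scoped ContDiff

/-- `N` is an embedded smooth submanifold of `ℝⁿ` (without boundary): around every point of `N`
some diffeomorphism between open subsets of `ℝⁿ` carries `N` onto an open part of a linear
subspace. The dimension of the subspace may depend on the connected component of `N`. -/
def IsSmoothSubmanifold {n : ℕ} (N : Set (EuclideanSpace ℝ (Fin n))) : Prop :=
  ∀ p ∈ N, ∃ (φ : OpenPartialHomeomorph (EuclideanSpace ℝ (Fin n)) (EuclideanSpace ℝ (Fin n)))
    (L : Submodule ℝ (EuclideanSpace ℝ (Fin n))),
    p ∈ φ.source ∧ ContDiffOn ℝ ∞ φ φ.source ∧ ContDiffOn ℝ ∞ φ.symm φ.target ∧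
      ∀ x ∈ φ.source, x ∈ N ↔ φ x ∈ L

/-- The tangent space `T_p N`: spanned by the velocities at `p` of the smooth curves in `N`
through `p` (for a submanifold these velocities already form a linear subspace). -/
noncomputable def tangentSpaceOf {n : ℕ} (N : Set (EuclideanSpace ℝ (Fin n))) (p : EuclideanSpace ℝ (Fin n)) :
    Submodule ℝ (EuclideanSpace ℝ (Fin n)) :=
  Submodule.span ℝ {v | ∃ (c : ℝ → EuclideanSpace ℝ (Fin n)) (ε : ℝ), 0 < ε ∧
    ContDiffOn ℝ ∞ c (Ioo (-ε) ε) ∧ (∀ t ∈ Ioo (-ε) ε, c t ∈ N) ∧ c 0 = p ∧ HasDerivAt c v 0}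

/-- The fibre at `p` of the normal bundle of `N`. -/
noncomputable def normalSpaceOf {n : ℕ} (N : Set (EuclideanSpace ℝ (Fin n))) (p : EuclideanSpace ℝ (Fin n)) :
    Submodule ℝ (EuclideanSpace ℝ (Fin n)) :=
  (tangentSpaceOf N p)ᗮ

/-- The Hessian of `f` at `p` as a bilinear form. -/
noncomputable def hessianAt {n : ℕ} (f : EuclideanSpace ℝ (Fin n) → ℝ)
    (p v w : EuclideanSpace ℝ (Fin n)) : ℝ :=
  fderiv ℝ (fderiv ℝ f) p v w

/-- The set of critical points of `f`. -/
def criticalSet {n : ℕ} (f : EuclideanSpace ℝ (Fin n) → ℝ) : Set (EuclideanSpace ℝ (Fin n)) :=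
  {p | fderiv ℝ f p = 0}

/-- `N` is a non-degenerate critical manifold of `f`: a submanifold consisting of critical points
at each of which the Hessian restricted to the normal space of `N` is non-degenerate. -/
structure IsNondegenerateCriticalManifold {n : ℕ} (f : EuclideanSpace ℝ (Fin n) → ℝ)
    (N : Set (EuclideanSpace ℝ (Fin n))) : Prop where
  submanifold : IsSmoothSubmanifold N
  critical : N ⊆ criticalSet f
  nondegenerate : ∀ p ∈ N, ∀ v ∈ normalSpaceOf N p,
    (∀ w ∈ normalSpaceOf N p, hessianAt f p v w = 0) → v = 0

/-- `f` is Morse–Bott: it is smooth and its critical set is a disjoint union of non-degenerate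
critical manifolds. -/
def IsMorseBott {n : ℕ} (f : EuclideanSpace ℝ (Fin n) → ℝ) : Prop :=
  ContDiff ℝ ∞ f ∧ ∃ 𝒩 : Set (Set (EuclideanSpace ℝ (Fin n))),
    𝒩.PairwiseDisjoint id ∧ ⋃₀ 𝒩 = criticalSet f ∧
      ∀ N ∈ 𝒩, IsNondegenerateCriticalManifold f N

/-- `γ` is a gradient flow of `f` on the interval `(a, b)`, where `-∞ ≤ a < b ≤ ∞`. Only the values
of `γ` on that interval matter. -/
def IsGradientFlow {n : ℕ} (f : EuclideanSpace ℝ (Fin n) → ℝ) (a b : EReal)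
    (γ : ℝ → EuclideanSpace ℝ (Fin n)) : Prop :=
  a < b ∧ ∀ t : ℝ, a < t → t < b → HasDerivAt γ (-gradient f (γ t)) t

/-! Every point p of N is a global minimum, so the Hessian at p is positive semidefinite. It cannot
vanish: Morse–Bott non-degeneracy would make the critical manifold through p a neighbourhood of p,
so f would vanish near p; the interior of the closed submanifold N is clopen, so f would vanish
everywhere. Hence the Hessian has a positive eigenvalue. Zero eigenvalues are then shifted away: for
0 < μ below that eigenvalue and off the spectrum, w = exp(μt)(γ - p) solves a hyperbolic system with
a small Lipschitz perturbation. A bounded non-zero w, found as a fixed point in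
`exists_bounded_solution_of_hyperbolic`, gives a curve γ tending to p exponentially. -/

open MeasureTheory BoundedContinuousFunction

/-! ### Bounded solutions of scalar linear equations -/

theorem integrableOn_exp_mul_mul_boundedContinuous {b : ℝ} (hb : 0 < b) (h : ℝ →ᵇ ℝ) (t : ℝ) :
    IntegrableOn (fun s => Real.exp (b * s) * h s) (Iic t) :=
  (integrableOn_exp_mul_Iic hb t).mul_bdd (c := ‖h‖)
    h.continuous.aestronglyMeasurable (.of_forall fun s => h.norm_coe_le_norm s)

/-- Bounded solutions on the whole line of the scalar equation `y' = -b y + h` for `b > 0`. -/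
theorem exists_bounded_linear_solution_of_pos {b : ℝ} (hb : 0 < b) :
    ∃ K : (ℝ →ᵇ ℝ) → (ℝ →ᵇ ℝ), (∀ h t, HasDerivAt (K h) (-b * K h t + h t) t) ∧
      K 0 = 0 ∧ ∀ h₁ h₂, ‖K h₁ - K h₂‖ ≤ ‖h₁ - h₂‖ / b := by
  set k : (ℝ →ᵇ ℝ) → ℝ → ℝ := fun h t =>
    Real.exp (-b * t) * ∫ s in Iic t, Real.exp (b * s) * h s with hk
  have int := fun h t => integrableOn_exp_mul_mul_boundedContinuous hb h t
  have deriv : ∀ h t, HasDerivAt (k h) (-b * k h t + h t) t := by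
    intro h t
    have h1 : HasDerivAt (fun t => ∫ s in Iic t, Real.exp (b * s) * h s)
        (Real.exp (b * t) * h t) t := by
      have h2 : HasDerivAt (fun t => ∫ s in (0 : ℝ)..t, Real.exp (b * s) * h s)
          (Real.exp (b * t) * h t) t := by
        have hc : Continuous fun s => Real.exp (b * s) * h s := by fun_prop
        exact intervalIntegral.integral_hasDerivAt_right (hc.intervalIntegrable _ _)
          (hc.stronglyMeasurableAtFilter _ _)
          hc.continuousAt
      refine (h2.const_add (∫ s in Iic (0 : ℝ), Real.exp (b * s) * h s)).congr_of_eventuallyEq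
        (.of_forall fun u => ?_)
      have := intervalIntegral.integral_Iic_sub_Iic (int h 0) (int h u)
      simp only at this ⊢
      linarith
    have h3 : HasDerivAt (fun t => Real.exp (-b * t)) (Real.exp (-b * t) * (-b)) t := by
      simpa using ((hasDerivAt_id t).const_mul (-b)).exp
    refine (h3.mul h1).congr_deriv ?_
    have h4 : Real.exp (-b * t) * Real.exp (b * t) = 1 := by
      rw [← Real.exp_add]; simp
    simp only [hk]
    linear_combination h t * h4
  have bound : ∀ (h : ℝ →ᵇ ℝ) t, ‖k h t‖ ≤ ‖h‖ / b := by
    intro h t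
    have h1 : ‖∫ s in Iic t, Real.exp (b * s) * h s‖ ≤
        ∫ s in Iic t, Real.exp (b * s) * ‖h‖ := by
      refine norm_integral_le_of_norm_le ((integrableOn_exp_mul_Iic hb t).mul_const _)
        (.of_forall fun s => ?_)
      rw [norm_mul, Real.norm_eq_abs, Real.abs_exp]
      gcongr
      exact h.norm_coe_le_norm s
    rw [integral_mul_const, integral_exp_mul_Iic hb] at h1
    have h4 : Real.exp (-b * t) * Real.exp (b * t) = 1 := by
      rw [← Real.exp_add]; simp
    calc ‖k h t‖ = Real.exp (-b * t) * ‖∫ s in Iic t, Real.exp (b * s) * h s‖ := by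
          rw [hk, norm_mul, Real.norm_eq_abs, Real.abs_exp]
      _ ≤ Real.exp (-b * t) * (Real.exp (b * t) / b * ‖h‖) := by gcongr
      _ = (Real.exp (-b * t) * Real.exp (b * t)) * (‖h‖ / b) := by ring
      _ = ‖h‖ / b := by rw [h4, one_mul]
  refine ⟨fun h => .ofNormedAddCommGroup (k h)
    (continuous_iff_continuousAt.2 fun t => (deriv h t).continuousAt) (‖h‖ / b) (bound h),
    deriv, by ext t; simp [hk], fun h₁ h₂ => ?_⟩
  refine (BoundedContinuousFunction.norm_le (by positivity)).2 fun t => ?_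
  have : k h₁ t - k h₂ t = k (h₁ - h₂) t := by
    simp only [hk, BoundedContinuousFunction.coe_sub, Pi.sub_apply, mul_sub]
    rw [integral_sub (int h₁ t) (int h₂ t), mul_sub]
  change ‖k h₁ t - k h₂ t‖ ≤ _
  exact this ▸ bound (h₁ - h₂) t

/-- Bounded solutions on the whole line of the scalar equation `y' = -b y + h` for `b ≠ 0`. -/
theorem exists_bounded_linear_solution {b : ℝ} (hb : b ≠ 0) :
    ∃ K : (ℝ →ᵇ ℝ) → (ℝ →ᵇ ℝ), (∀ h t, HasDerivAt (K h) (-b * K h t + h t) t) ∧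
      K 0 = 0 ∧ ∀ h₁ h₂, ‖K h₁ - K h₂‖ ≤ ‖h₁ - h₂‖ / |b| := by
  rcases hb.lt_or_gt with hb | hb
  -- Time reversal turns the unstable equation into the stable one.
  · obtain ⟨K, hK, h0, hL⟩ := exists_bounded_linear_solution_of_pos (neg_pos.2 hb)
    let r : C(ℝ, ℝ) := ⟨fun t => -t, continuous_neg⟩
    refine ⟨fun h => -(K (h.compContinuous r)).compContinuous r, fun h t => ?_,
      by ext t; simp [h0], fun h₁ h₂ => ?_⟩
    · have h1 := ((hK (h.compContinuous r) (-t)).scomp t (hasDerivAt_neg t)).neg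
      refine h1.congr_deriv ?_
      simp [r]
    · rw [abs_of_neg hb]
      refine (BoundedContinuousFunction.norm_le
        (div_nonneg (norm_nonneg _) (neg_pos.2 hb).le)).2 fun t => ?_
      have h1 := (K (h₁.compContinuous r) - K (h₂.compContinuous r)).norm_coe_le_norm (-t)
      have h2 := hL (h₁.compContinuous r) (h₂.compContinuous r)
      have h3 : ‖h₁.compContinuous r - h₂.compContinuous r‖ ≤ ‖h₁ - h₂‖ :=
        (BoundedContinuousFunction.norm_le (norm_nonneg _)).2 fun s =>
          (h₁ - h₂).norm_coe_le_norm (-s)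
      calc _ = ‖(K (h₁.compContinuous r) - K (h₂.compContinuous r)) (-t)‖ := by
            simp only [BoundedContinuousFunction.coe_sub, BoundedContinuousFunction.coe_neg,
              Pi.sub_apply, Pi.neg_apply, BoundedContinuousFunction.compContinuous_apply]
            rw [← norm_neg]; congr 1; simp [r]; ring
        _ ≤ ‖h₁ - h₂‖ / -b := h1.trans (h2.trans (by
            have := neg_pos.2 hb
            gcongr))
  · rw [abs_of_pos hb]
    exact exists_bounded_linear_solution_of_pos hb

/-! ### The Lyapunov–Perron method -/

/-- Lyapunov–Perron: a small Lipschitz perturbation of a diagonal hyperbolic linear system with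
some stable direction has a non-zero bounded solution on `(0, ∞)`. -/
theorem exists_bounded_solution_of_hyperbolic {ι : Type*} [Fintype ι] {b : ι → ℝ} {δ : ℝ}
    (hδ : 0 < δ) (hb : ∀ i, δ ≤ |b i|) {i₀ : ι} (hi₀ : 0 < b i₀) {G : ℝ → (ι → ℝ) → ι → ℝ}
    (hGc : Continuous (Function.uncurry G)) (hG0 : ∀ t, G t 0 = 0)
    (hG : ∀ t x y, ‖G t x - G t y‖ ≤ δ / 4 * ‖x - y‖) {η : ℝ} (hη : 0 < η) :
    ∃ w : ℝ → ι → ℝ, Continuous w ∧ (∀ t, ‖w t‖ ≤ 2 * η) ∧ w 0 i₀ ≠ 0 ∧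
      ∀ t > 0, HasDerivAt w (fun i => -b i * w t i + G t (w t) i) t := by
  classical
  have hb0 : ∀ i, b i ≠ 0 := fun i => abs_pos.1 (hδ.trans_le (hb i))
  choose K hK hK0 hKL using fun i => exists_bounded_linear_solution (hb0 i)
  have hG' : ∀ t x, ‖G t x‖ ≤ δ / 4 * ‖x‖ := fun t x => by simpa [hG0] using hG t x 0
  let N : (ℝ →ᵇ (ι → ℝ)) → ι → (ℝ →ᵇ ℝ) := fun w i => .ofNormedAddCommGroup
    (fun t => G t (w t) i)
    ((continuous_apply i).comp (hGc.comp (continuous_id.prodMk w.continuous))) (δ / 4 * ‖w‖)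
    fun t => (norm_le_pi_norm (G t (w t)) i).trans ((hG' t (w t)).trans (by
      gcongr; exact w.norm_coe_le_norm t))
  have hNL : ∀ w₁ w₂ i, ‖N w₁ i - N w₂ i‖ ≤ δ / 4 * ‖w₁ - w₂‖ := fun w₁ w₂ i =>
    (BoundedContinuousFunction.norm_le (by positivity)).2 fun t =>
      (norm_le_pi_norm (G t (w₁ t) - G t (w₂ t)) i).trans ((hG t _ _).trans (by
        gcongr; exact (w₁ - w₂).norm_coe_le_norm t))
  have hKN : ∀ w₁ w₂ i, ‖K i (N w₁ i) - K i (N w₂ i)‖ ≤ 1 / 4 * ‖w₁ - w₂‖ := fun w₁ w₂ i => by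
    refine (hKL i _ _).trans ?_
    rw [div_le_iff₀ (abs_pos.2 (hb0 i))]
    refine (hNL w₁ w₂ i).trans ?_
    have := hb i
    have := mul_le_mul_of_nonneg_right this (norm_nonneg (w₁ - w₂))
    linarith
  -- The decaying homogeneous solution in the stable direction, frozen for t < 0 to stay bounded on
  -- the whole line; it makes the fixed point non-zero.
  let z : ℝ → ι → ℝ := fun t => Pi.single i₀ (η * Real.exp (-b i₀ * max t 0))
  have hz : ∀ t, ‖z t‖ ≤ η := fun t => by
    simp only [z, Pi.norm_single]
    rw [norm_mul, Real.norm_eq_abs, Real.norm_eq_abs, Real.abs_exp, abs_of_pos hη]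
    refine mul_le_of_le_one_right hη.le (Real.exp_le_one_iff.2 ?_)
    have := mul_nonneg hi₀.le (le_max_right t 0)
    linarith
  have hzc : Continuous z := by
    refine (continuous_single i₀).comp ?_
    fun_prop
  let Z : ℝ →ᵇ (ι → ℝ) := .ofNormedAddCommGroup z hzc η hz
  let Q : (ℝ →ᵇ (ι → ℝ)) → (ℝ →ᵇ (ι → ℝ)) := fun w => .ofNormedAddCommGroup
    (fun t i => K i (N w i) t) (by fun_prop) (∑ i, ‖K i (N w i)‖) fun t =>
      (pi_norm_le_iff_of_nonneg (by positivity)).2 fun i =>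
        ((K i (N w i)).norm_coe_le_norm t).trans
          (Finset.single_le_sum (f := fun i => ‖K i (N w i)‖) (fun _ _ => norm_nonneg _)
            (Finset.mem_univ i))
  have hQ : ∀ w₁ w₂, ‖Q w₁ - Q w₂‖ ≤ 1 / 4 * ‖w₁ - w₂‖ := fun w₁ w₂ =>
    (BoundedContinuousFunction.norm_le (by positivity)).2 fun t =>
      (pi_norm_le_iff_of_nonneg (by positivity)).2 fun i =>
        ((K i (N w₁ i) - K i (N w₂ i)).norm_coe_le_norm t).trans (hKN w₁ w₂ i)
  have hN0 : ∀ i, N 0 i = 0 := fun i => by ext t; simp [N, hG0]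
  have hQ0 : Q 0 = 0 := by ext t i; simp [Q, hN0, hK0]
  have hcontr : ContractingWith (1 / 4 : NNReal) fun w => Z + Q w := by
    refine ⟨by norm_num, LipschitzWith.of_dist_le_mul fun w₁ w₂ => ?_⟩
    rw [dist_eq_norm, dist_eq_norm, add_sub_add_left_eq_sub]
    simpa using hQ w₁ w₂
  set w := hcontr.fixedPoint
  have hw : Z + Q w = w := hcontr.fixedPoint_isFixedPt
  have hQw : ‖Q w‖ ≤ 1 / 4 * ‖w‖ := by simpa [hQ0] using hQ w 0
  have hZ : ‖Z‖ ≤ η := (BoundedContinuousFunction.norm_le hη.le).2 hz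
  have hwn : ‖w‖ ≤ η + 1 / 4 * ‖w‖ := by
    conv_lhs => rw [← hw]
    exact (norm_add_le _ _).trans (add_le_add hZ hQw)
  have hwt : ∀ t, w t = z t + Q w t := fun t => (DFunLike.congr_fun hw t).symm
  refine ⟨w, w.continuous, fun t => (w.norm_coe_le_norm t).trans (by linarith), ?_, ?_⟩
  -- Since ‖w‖ ≤ 4η/3, the correction is at most η/3 and cannot cancel η.
  · have h1 : w 0 i₀ = η + Q w 0 i₀ := by
      rw [hwt 0]; simp [z]
    have h2 : |Q w 0 i₀| ≤ 1 / 4 * ‖w‖ :=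
      (norm_le_pi_norm (Q w 0) i₀).trans (((Q w).norm_coe_le_norm 0).trans hQw)
    rw [h1]
    have := (abs_le.1 h2).1
    exact ne_of_gt (by linarith)
  · intro t ht
    refine hasDerivAt_pi.2 fun i => ?_
    have h1 : HasDerivAt (fun t => z t i) (-b i * z t i) t := by
      by_cases hi : i = i₀
      · subst hi
        have h2 : HasDerivAt (fun t => η * Real.exp (-b i * t))
            (-b i * (η * Real.exp (-b i * t))) t := by
          refine ((((hasDerivAt_id t).const_mul (-b i)).exp).const_mul η).congr_deriv ?_
          simp; ring
        simp only [z, Pi.single_eq_same, max_eq_left ht.le]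
        refine h2.congr_of_eventuallyEq ?_
        filter_upwards [lt_mem_nhds ht] with s hs
        rw [max_eq_left hs.le]
      · simp only [z, Pi.single_eq_of_ne hi, mul_zero]
        exact hasDerivAt_const t 0
    have h2 := h1.add (hK i (N w i) t)
    refine (h2.congr_of_eventuallyEq (.of_forall fun s => ?_)).congr_deriv ?_
    · rw [hwt s]; rfl
    · rw [hwt t]
      change _ = -b i * (z t i + K i (N w i) t) + G t (z t + Q w t) i
      rw [← hwt t]
      change _ + (_ + G t (w t) i) = _
      ring

/-- If `F` vanishes at `0` and its derivative there is diagonal with some positive entry, then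
`γ' = -F(γ)` has a non-zero solution on `(0, ∞)` that converges to `0`. -/
theorem exists_trajectory_tendsto_zero {ι : Type*} [Fintype ι] {F : (ι → ℝ) → ι → ℝ}
    {D : (ι → ℝ) →L[ℝ] (ι → ℝ)} (hF0 : F 0 = 0) (hD : HasStrictFDerivAt F D 0) {a : ι → ℝ}
    (hDa : ∀ x i, D x i = a i * x i) {i₀ : ι} (hi₀ : 0 < a i₀) :
    ∃ γ : ℝ → ι → ℝ, Continuous γ ∧ γ 0 ≠ 0 ∧ (∀ t > 0, HasDerivAt γ (-F (γ t)) t) ∧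
      Tendsto γ atTop (𝓝 0) := by
  classical
  -- Avoiding the finitely many a i makes the shifted system hyperbolic, while μ < a i₀ keeps i₀
  -- stable.
  obtain ⟨μ, ⟨hμ0, hμ⟩, hμa⟩ :=
    ((Ioo_infinite hi₀).sdiff (finite_range a)).nonempty
  have hb : ∀ i, a i - μ ≠ 0 := fun i h => hμa ⟨i, by linarith⟩
  obtain ⟨δ, hδ, hδb⟩ : ∃ δ > 0, ∀ i, δ ≤ |a i - μ| := by
    obtain ⟨j, -, hj⟩ := Finset.exists_min_image Finset.univ (fun i => |a i - μ|)
      ⟨i₀, Finset.mem_univ i₀⟩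
    exact ⟨|a j - μ|, abs_pos.2 (hb j), fun i => hj i (Finset.mem_univ i)⟩
  have hR : HasStrictFDerivAt (fun x => F x - D x) (0 : (ι → ℝ) →L[ℝ] (ι → ℝ)) 0 := by
    have h1 := hD.sub (D.hasStrictFDerivAt (x := 0))
    rw [sub_self] at h1
    exact h1
  obtain ⟨s, hs, hsL⟩ := hR.exists_lipschitzOnWith_of_nnnorm_lt (⟨δ / 4, by positivity⟩ : NNReal)
    (by rw [nnnorm_zero]; exact NNReal.coe_pos.1 (show (0 : ℝ) < δ / 4 by positivity))
  -- The remainder F - D is small-Lipschitz only near 0, so it is extended globally; the bound 2 *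
  -- (r / 2) on w keeps the curve where the extension agrees with it.
  obtain ⟨g, hg, hgs⟩ := hsL.extend_pi
  obtain ⟨r, hr, hrs⟩ := Metric.nhds_basis_closedBall.mem_iff.1 hs
  have hg0 : g 0 = 0 := by
    rw [← hgs (mem_of_mem_nhds hs)]; simp [hF0]
  have hgL : ∀ x y, ‖g x - g y‖ ≤ δ / 4 * ‖x - y‖ := fun x y => by
    rw [← dist_eq_norm, ← dist_eq_norm]; exact hg.dist_le_mul x y
  obtain ⟨w, hwc, hwr, hw0, hw⟩ := exists_bounded_solution_of_hyperbolic hδ hδb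
    (sub_pos.2 hμ)
    (G := fun t x => -(Real.exp (μ * max t 0) • g (Real.exp (-(μ * max t 0)) • x)))
    (by
      have := hg.continuous
      simp only [Function.uncurry_def]
      fun_prop)
    (by simp [hg0])
    (fun t x y => by
      rw [← neg_sub', norm_neg, ← smul_sub, norm_smul, Real.norm_eq_abs, Real.abs_exp]
      have h1 := hgL (Real.exp (-(μ * max t 0)) • x) (Real.exp (-(μ * max t 0)) • y)
      rw [← smul_sub, norm_smul, Real.norm_eq_abs, Real.abs_exp] at h1
      have h2 : Real.exp (μ * max t 0) * Real.exp (-(μ * max t 0)) = 1 := by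
        rw [← Real.exp_add]; simp
      calc _ ≤ Real.exp (μ * max t 0) * (δ / 4 * (Real.exp (-(μ * max t 0)) * ‖x - y‖)) := by
            gcongr
        _ = (Real.exp (μ * max t 0) * Real.exp (-(μ * max t 0))) * (δ / 4 * ‖x - y‖) := by ring
        _ = _ := by rw [h2, one_mul])
    (half_pos hr)
  refine ⟨fun t => Real.exp (-(μ * t)) • w t, by fun_prop, fun h => hw0 ?_, fun t ht => ?_, ?_⟩
  · have : w 0 = 0 := by simpa using h
    simp [this]
  · have hmem : Real.exp (-(μ * t)) • w t ∈ s := hrs (by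
      rw [mem_closedBall_zero_iff, norm_smul, Real.norm_eq_abs, Real.abs_exp]
      have h1 : Real.exp (-(μ * t)) ≤ 1 := Real.exp_le_one_iff.2 (by
        have := mul_pos hμ0 ht
        linarith)
      have h2 := hwr t
      calc _ ≤ 1 * ‖w t‖ := by gcongr
        _ ≤ r := by linarith)
    have he : HasDerivAt (fun t => Real.exp (-(μ * t))) (Real.exp (-(μ * t)) * -μ) t := by
      simpa using (((hasDerivAt_id t).const_mul μ).neg).exp
    refine (he.smul (hw t ht)).congr_deriv ?_
    have hFg : F (Real.exp (-(μ * t)) • w t) =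
        D (Real.exp (-(μ * t)) • w t) + g (Real.exp (-(μ * t)) • w t) := by
      rw [← hgs hmem]; exact (add_sub_cancel _ _).symm
    have h2 : Real.exp (-(μ * t)) * Real.exp (μ * t) = 1 := by
      rw [← Real.exp_add]; simp
    ext i
    rw [hFg]
    simp only [Pi.add_apply, Pi.smul_apply, Pi.neg_apply, smul_eq_mul, hDa, max_eq_left ht.le]
    linear_combination (-g (Real.exp (-(μ * t)) • w t) i) * h2
  · have he : Tendsto (fun t => Real.exp (-(μ * t))) atTop (𝓝 0) :=
      Real.tendsto_exp_neg_atTop_nhds_zero.comp (tendsto_id.const_mul_atTop hμ0)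
    refine squeeze_zero_norm (a := fun t => Real.exp (-(μ * t)) * r) (fun t => ?_)
      (by simpa using he.mul_const r)
    rw [norm_smul, Real.norm_eq_abs, Real.abs_exp]
    gcongr
    linarith [hwr t]

/-! ### Gradient flow near a minimum with non-zero Hessian -/

section Euclidean

variable {n : ℕ} {f : EuclideanSpace ℝ (Fin n) → ℝ} {p : EuclideanSpace ℝ (Fin n)}

theorem hessianAt_self_nonneg_of_forall_le (hf : ContDiff ℝ ∞ f) (hp : ∀ x, f p ≤ f x)
    (v : EuclideanSpace ℝ (Fin n)) : 0 ≤ hessianAt f p v v := by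
  by_contra! hneg
  set c := hessianAt f p v v with hc
  have hline : ∀ t : ℝ, HasDerivAt (fun t : ℝ => p + t • v) v t := fun t => by
    simpa using ((hasDerivAt_id t).smul_const v).const_add p
  have hfd : Differentiable ℝ f := hf.differentiable (by simp)
  have hfd2 : Differentiable ℝ (fderiv ℝ f) :=
    ((contDiff_infty.1 hf 2).fderiv_right (m := 1) (by norm_num)).differentiable (by simp)
  -- Subtracting only half of the quadratic term leaves second derivative c / 2 < 0, so a local
  -- maximum at 0; then f (p + t • v) ≤ f p + c / 4 * t ^ 2 < f p for small t ≠ 0.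
  have h1 : ∀ t, HasDerivAt (fun t : ℝ => f (p + t • v) - c / 4 * t ^ 2)
      (fderiv ℝ f (p + t • v) v - c / 2 * t) t := fun t => by
    refine (((hfd _).hasFDerivAt.comp_hasDerivAt t (hline t)).sub
      ((hasDerivAt_pow 2 t).const_mul (c / 4))).congr_deriv ?_
    simp; ring
  have h2 : HasDerivAt (fun t : ℝ => fderiv ℝ f (p + t • v) v - c / 2 * t) (c / 2) 0 := by
    have h3 : HasDerivAt (fun t : ℝ => fderiv ℝ f (p + t • v)) (fderiv ℝ (fderiv ℝ f) p v) 0 := by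
      have h4 := (hfd2 (p + (0 : ℝ) • v)).hasFDerivAt.comp_hasDerivAt 0 (hline 0)
      simpa [Function.comp_def] using h4
    refine ((h3.clm_apply (hasDerivAt_const 0 v)).sub
      ((hasDerivAt_id (0 : ℝ)).const_mul (c / 2))).congr_deriv ?_
    simp only [map_zero, add_zero, mul_one]
    change c - c / 2 = c / 2
    ring
  have hcrit : fderiv ℝ f p = 0 :=
    IsLocalMin.fderiv_eq_zero (.of_forall hp)
  have hmax := isLocalMax_of_deriv_deriv_neg (f := fun t : ℝ => f (p + t • v) - c / 4 * t ^ 2)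
    (x₀ := 0) (by rw [funext fun t => (h1 t).deriv, h2.deriv]; linarith)
    (by rw [(h1 0).deriv]; simp [hcrit]) (h1 0).continuousAt
  obtain ⟨ε, hε, hmax⟩ := Metric.eventually_nhds_iff.1 hmax
  have h5 := @hmax (ε / 2) (by simpa [abs_of_pos hε] using hε)
  have h6 := hp (p + (ε / 2) • v)
  have h7 : 0 < (ε / 2) ^ 2 := by positivity
  simp at h5
  nlinarith

/-- A non-zero symmetric positive semidefinite operator has a positive eigenvalue; in an orthonormal
eigenbasis the linearised gradient is diagonal. -/
theorem exists_gradientFlow_of_hessianAt_ne_zero (hf : ContDiff ℝ ∞ f) (hp : ∀ x, f p ≤ f x)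
    {v₀ w₀ : EuclideanSpace ℝ (Fin n)} (hH : hessianAt f p v₀ w₀ ≠ 0) :
    ∃ γ : ℝ → EuclideanSpace ℝ (Fin n), Continuous γ ∧ γ 0 ≠ p ∧
      (∀ t > 0, HasDerivAt γ (-gradient f (γ t)) t) ∧ Tendsto γ atTop (𝓝 p) := by
  have hfd : Differentiable ℝ f := hf.differentiable (by simp)
  have hfd1 : ContDiff ℝ 1 (fderiv ℝ f) := (contDiff_infty.1 hf 2).fderiv_right (m := 1) (by norm_num)
  have hcrit : fderiv ℝ f p = 0 := IsLocalMin.fderiv_eq_zero (.of_forall hp)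
  let J : (EuclideanSpace ℝ (Fin n) →L[ℝ] ℝ) →L[ℝ] EuclideanSpace ℝ (Fin n) :=
    ⟨⟨⟨(InnerProductSpace.toDual ℝ (EuclideanSpace ℝ (Fin n))).symm, map_add _⟩,
      fun c x => by simp⟩, LinearIsometryEquiv.continuous _⟩
  let H : EuclideanSpace ℝ (Fin n) →L[ℝ] EuclideanSpace ℝ (Fin n) :=
    J.comp (fderiv ℝ (fderiv ℝ f) p)
  have hHi : ∀ v w, inner ℝ (H v) w = hessianAt f p v w := fun v w =>
    InnerProductSpace.toDual_symm_apply
  have hgrad : HasStrictFDerivAt (gradient f) H p :=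
    J.hasStrictFDerivAt.comp p
      (hfd1.contDiffAt.hasStrictFDerivAt one_ne_zero)
  have hsymm : (H : EuclideanSpace ℝ (Fin n) →ₗ[ℝ] EuclideanSpace ℝ (Fin n)).IsSymmetric := by
    intro v w
    have h1 : IsSymmSndFDerivAt ℝ f p :=
      (contDiff_infty.1 hf 2).contDiffAt.isSymmSndFDerivAt (by simp)
    have h2 : hessianAt f p v w = hessianAt f p w v := h1 v w
    change inner ℝ (H v) w = inner ℝ v (H w)
    rw [real_inner_comm (H w) v, hHi, hHi, h2]
  have hn : Module.finrank ℝ (EuclideanSpace ℝ (Fin n)) = n := finrank_euclideanSpace_fin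
  let b := hsymm.eigenvectorBasis hn
  let a := hsymm.eigenvalues hn
  have hba : ∀ i, H (b i) = a i • b i := fun i => by
    exact hsymm.apply_eigenvectorBasis hn i
  obtain ⟨i₀, hi₀⟩ : ∃ i, 0 < a i := by
    by_contra! hneg
    have ha : ∀ i, a i = 0 := fun i => le_antisymm (hneg i) (by
      have h1 := hessianAt_self_nonneg_of_forall_le hf hp (b i)
      rw [← hHi, hba, inner_smul_left] at h1
      simpa using h1)
    have h2 : (H : EuclideanSpace ℝ (Fin n) →ₗ[ℝ] EuclideanSpace ℝ (Fin n)) = 0 :=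
      b.toBasis.ext fun i => by simp [hba, ha]
    have h3 : H v₀ = 0 := LinearMap.congr_fun h2 v₀
    rw [← hHi, h3, inner_zero_left] at hH
    exact hH rfl
  let T : EuclideanSpace ℝ (Fin n) ≃L[ℝ] (Fin n → ℝ) :=
    b.repr.toContinuousLinearEquiv.trans (EuclideanSpace.equiv (Fin n) ℝ)
  have hT : ∀ x i, T x i = inner ℝ (b i) x := fun x i => b.repr_apply_apply x i
  have hline : HasStrictFDerivAt (fun y => p + T.symm y) (T.symm : (Fin n → ℝ) →L[ℝ] _) 0 :=
    T.symm.hasStrictFDerivAt.const_add p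
  obtain ⟨γ, hγc, hγ0, hγ, hγt⟩ := exists_trajectory_tendsto_zero
    (F := fun y => T (gradient f (p + T.symm y)))
    (D := (T : _ →L[ℝ] (Fin n → ℝ)).comp (H.comp (T.symm : (Fin n → ℝ) →L[ℝ] _)))
    (by simp [gradient, hcrit])
    (T.hasStrictFDerivAt.comp 0 (HasStrictFDerivAt.comp 0 (by simpa using hgrad) hline))
    (a := a)
    (fun x i => by
      have h1 : inner ℝ (b i) (H (T.symm x)) = inner ℝ (H (b i)) (T.symm x) :=
        (hsymm (b i) (T.symm x)).symm
      change T (H (T.symm x)) i = _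
      rw [hT, h1, hba, inner_smul_left, ← hT]
      simp)
    hi₀
  refine ⟨fun t => p + T.symm (γ t), by fun_prop, fun h => hγ0 (by simpa using h),
    fun t ht => ?_, ?_⟩
  · have h1 := (T.symm.hasFDerivAt.comp_hasDerivAt t (hγ t ht)).const_add p
    refine h1.congr_deriv ?_
    simp
  · have h1 := ((T.symm.continuous.tendsto 0).comp hγt).const_add p
    simpa [Function.comp_def] using h1

end Euclidean

/-! ### Interiors of submanifolds and critical sets -/

section Submanifold

variable {n : ℕ} {N : Set (EuclideanSpace ℝ (Fin n))} {p : EuclideanSpace ℝ (Fin n)}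

/-- In a chart at a limit point of the interior, the model subspace contains a non-empty open set,
so it is the whole space. -/
theorem isClosed_interior_of_isSmoothSubmanifold (hN : IsSmoothSubmanifold N)
    (hc : IsClosed N) : IsClosed (interior N) := by
  refine closure_subset_iff_isClosed.1 fun q hq => ?_
  obtain ⟨φ, L, hqφ, -, -, hφ⟩ := hN q (closure_minimal interior_subset hc hq)
  obtain ⟨x, hxφ, hxN⟩ := mem_closure_iff.1 hq _ φ.open_source hqφ
  have hopen : IsOpen (φ '' (φ.source ∩ interior N)) :=
    φ.isOpen_image_of_subset_source (φ.open_source.inter isOpen_interior) inter_subset_left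
  have hsub : φ '' (φ.source ∩ interior N) ⊆ L := by
    rintro _ ⟨y, ⟨hy, hyN⟩, rfl⟩
    exact (hφ y hy).1 (interior_subset hyN)
  have hL : L = ⊤ := L.eq_top_of_nonempty_interior'
    ⟨φ x, interior_maximal hsub hopen ⟨x, ⟨hxφ, hxN⟩, rfl⟩⟩
  exact mem_interior.2 ⟨φ.source, fun y hy => (hφ y hy).2 (by simp [hL]), φ.open_source, hqφ⟩

/-- The chart's derivative is onto and sends velocities of curves in N into the model subspace, as
limits of difference quotients. -/
theorem mem_interior_of_tangentSpaceOf_eq_top (hN : IsSmoothSubmanifold N) (hp : p ∈ N)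
    (hT : tangentSpaceOf N p = ⊤) : p ∈ interior N := by
  obtain ⟨φ, L, hpφ, hφs, hφt, hφ⟩ := hN p hp
  have hd : HasFDerivAt φ (fderiv ℝ φ p) p :=
    ((hφs.contDiffAt (φ.open_source.mem_nhds hpφ)).differentiableAt (by simp)).hasFDerivAt
  have hd' : HasFDerivAt φ.symm (fderiv ℝ φ.symm (φ p)) (φ p) :=
    ((hφt.contDiffAt (φ.open_target.mem_nhds (φ.map_source hpφ))).differentiableAt
      (by simp)).hasFDerivAt
  have hid : (fderiv ℝ φ p).comp (fderiv ℝ φ.symm (φ p)) = ContinuousLinearMap.id ℝ _ := by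
    have h1 : HasFDerivAt φ (fderiv ℝ φ p) (φ.symm (φ p)) := by rwa [φ.left_inv hpφ]
    refine (h1.comp (φ p) hd').unique ((hasFDerivAt_id (φ p)).congr_of_eventuallyEq ?_)
    filter_upwards [φ.open_target.mem_nhds (φ.map_source hpφ)] with y hy
    exact φ.right_inv hy
  have hle : tangentSpaceOf N p ≤ L.comap (fderiv ℝ φ p : _ →ₗ[ℝ] _) := by
    refine Submodule.span_le.2 ?_
    rintro v ⟨c, ε, hε, -, hcN, hc0, hcv⟩
    have hL : IsClosed (L : Set (EuclideanSpace ℝ (Fin n))) := L.closed_of_finiteDimensional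
    have h1 : HasDerivAt (φ ∘ c) (fderiv ℝ φ p v) 0 :=
      (show HasFDerivAt φ (fderiv ℝ φ p) (c 0) by rwa [hc0]).comp_hasDerivAt 0 hcv
    have h2 : ∀ᶠ t in 𝓝[≠] (0 : ℝ), slope (φ ∘ c) 0 t ∈ L := by
      have h3 : ∀ᶠ t in 𝓝 (0 : ℝ), c t ∈ φ.source :=
        hcv.continuousAt.eventually_mem (by rw [hc0]; exact φ.open_source.mem_nhds hpφ)
      have h4 : ∀ᶠ t in 𝓝 (0 : ℝ), t ∈ Ioo (-ε) ε := Ioo_mem_nhds (by linarith) hε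
      filter_upwards [nhdsWithin_le_nhds h3, nhdsWithin_le_nhds h4] with t ht1 ht2
      rw [slope_def_module]
      refine L.smul_mem _ (L.sub_mem ((hφ _ ht1).1 (hcN t ht2)) ?_)
      rw [Function.comp_apply, hc0]
      exact (hφ p hpφ).1 hp
    exact hL.mem_of_tendsto h1.tendsto_slope h2
  have hLtop : L = ⊤ := by
    refine eq_top_iff.2 fun y _ => ?_
    have h1 : fderiv ℝ φ.symm (φ p) y ∈ tangentSpaceOf N p := by simp [hT]
    have h2 := hle h1
    have h3 : fderiv ℝ φ p (fderiv ℝ φ.symm (φ p) y) = y := DFunLike.congr_fun hid y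
    rw [Submodule.mem_comap] at h2
    exact h3 ▸ h2
  exact mem_interior.2 ⟨φ.source, fun y hy => (hφ y hy).2 (by simp [hLtop]), φ.open_source, hpφ⟩

theorem IsMorseBott.mem_interior_criticalSet_of_hessianAt_eq_zero
    {f : EuclideanSpace ℝ (Fin n) → ℝ} (hf : IsMorseBott f) (hp : p ∈ criticalSet f)
    (hH : ∀ v w, hessianAt f p v w = 0) : p ∈ interior (criticalSet f) := by
  obtain ⟨-, 𝒩, -, hU, h𝒩⟩ := hf
  rw [← hU] at hp
  obtain ⟨C, hC, hpC⟩ := hp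
  have hn : normalSpaceOf C p = ⊥ := eq_bot_iff.2 fun v hv =>
    (h𝒩 C hC).nondegenerate p hpC v hv fun w _ => hH v w
  exact interior_mono (h𝒩 C hC).critical (mem_interior_of_tangentSpaceOf_eq_top
    (h𝒩 C hC).submanifold hpC ((Submodule.orthogonal_eq_bot_iff).1 hn))

end Submanifold

/-! ### The main theorem -/

theorem mainTheorem6 (n : ℕ) (f : EuclideanSpace ℝ (Fin n) → ℝ)
    (hf : IsMorseBott f) (hnonneg : ∀ x, 0 ≤ f x) (hne : ∃ x, f x ≠ 0)
    (hN : IsSmoothSubmanifold (f ⁻¹' {0})) (hN_nonempty : (f ⁻¹' {0}).Nonempty) :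
    ∀ p ∈ f ⁻¹' {0}, ∃ (a : EReal) (γ : ℝ → EuclideanSpace ℝ (Fin n)),
      IsGradientFlow f a ⊤ γ ∧
      (∃ s t : ℝ, a < s ∧ a < t ∧ γ s ≠ γ t) ∧
      Tendsto γ atTop (𝓝 p) := by
  intro p hp
  have hp0 : f p = 0 := hp
  have hmin : ∀ x, f p ≤ f x := fun x => hp0 ▸ hnonneg x
  have hfd : Differentiable ℝ f := hf.1.differentiable (by simp)
  obtain ⟨v, w, hvw⟩ : ∃ v w, hessianAt f p v w ≠ 0 := by
    by_contra! hH
    have hcrit : p ∈ criticalSet f := IsLocalMin.fderiv_eq_zero (.of_forall hmin)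
    obtain ⟨r, hr, hball⟩ := Metric.isOpen_iff.1 isOpen_interior p
      (hf.mem_interior_criticalSet_of_hessianAt_eq_zero hcrit hH)
    have hpint : p ∈ interior (f ⁻¹' {0}) := by
      refine mem_interior.2 ⟨Metric.ball p r, fun x hx => ?_, Metric.isOpen_ball,
        Metric.mem_ball_self hr⟩
      have h1 := Metric.isOpen_ball.is_const_of_fderiv_eq_zero
        (convex_ball p r).isPreconnected hfd.differentiableOn
        (fun y hy => (interior_subset (hball hy) : y ∈ criticalSet f)) hx (Metric.mem_ball_self hr)
      exact h1.trans hp0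
    have huniv : interior (f ⁻¹' {0}) = univ := IsClopen.eq_univ
      ⟨isClosed_interior_of_isSmoothSubmanifold hN
        (isClosed_singleton.preimage hfd.continuous), isOpen_interior⟩ ⟨p, hpint⟩
    obtain ⟨x, hx⟩ := hne
    have h1 : x ∈ interior (f ⁻¹' {0}) := huniv ▸ mem_univ x
    exact hx (interior_subset h1 : x ∈ f ⁻¹' {0})
  obtain ⟨γ, hγc, hγ0, hγ, hγt⟩ := exists_gradientFlow_of_hessianAt_ne_zero hf.1 hmin hvw
  refine ⟨0, γ, ⟨EReal.zero_lt_top, fun t ht _ => hγ t (by exact_mod_cast ht)⟩, ?_, hγt⟩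
  -- A curve constant on t > 0 would equal its limit p there, hence also at 0 by continuity.
  by_contra! hconst
  have h1 : ∀ s > 0, γ s = p := fun s hs => by
    refine tendsto_nhds_unique (tendsto_const_nhds.congr' ?_) hγt
    filter_upwards [eventually_gt_atTop 0] with t ht
    exact hconst s t (by exact_mod_cast hs) (by exact_mod_cast ht)
  have h2 : Tendsto γ (𝓝[>] 0) (𝓝 (γ 0)) := hγc.continuousAt.mono_left nhdsWithin_le_nhds
  refine hγ0 (tendsto_nhds_unique h2 (tendsto_const_nhds.congr' ?_))
  filter_upwards [self_mem_nhdsWithin] with s hs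
  exact (h1 s hs).symm
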